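/- **Setting.** All bundles are holomorphic vector bundles on the complex projective line $\mathbb P^1$, with canonical bundle $K=\mathcal O(-2)$, $K^*=\mathcal O(2)$. A co-Higgs bundle is a pair $(E,\phi)$ with $E$ a holomorphic vector bundle and $\phi\in H^0(\mathbb P^1;\operatorname{End}E\otimes\mathcal O(2))$; it is stable (semistable) if $E\neq 0$ and $\deg U/\operatorname{rk}U<\deg E/\operatorname{rk}E$ (respectively $\le$) for each proper nonzero subbundle $U\subset E$ with $\phi(U)\subseteq U\otimes\mathcal O(2)$. Two semistable co-Higgs bundles are S-equivalent if the associated graded objects of their Jordan–Hölder filtrations are isomorphic, and $\mathcal M_0(2,0)$ denotes the set of S-equivalence classes of semistable co-Higgs bundles with $\operatorname{rk}E=2$, $\deg E=0$, $\operatorname{Tr}\phi=0$. The Hitchin map $h:\mathcal M_0(2,0)\to H^0(\mathbb P^1;\mathcal O(4))$ sends the class of $(E,\phi)$ to $\det\phi$, the constant coefficient of the characteristic polynomial $\eta^2+\det\phi$. For $\rho\in H^0(\mathbb P^1;\mathcal O(4))$ let $$Q(\rho)=\begin{pmatrix}0&-\rho\\1&0\end{pmatrix},$$ a Higgs field for $E^1_{-1}=\mathcal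 O(1)\oplus\mathcal O(-1)$. **Proposition 8.1.** For every $\rho\in H^0(\mathbb P^1;\mathcal O(4))$ the co-Higgs bundle $(E^1_{-1},Q(\rho))$ is stable and represents a point of $\mathcal M_0(2,0)$, and $\rho\mapsto[(E^1_{-1},Q(\rho))]$ is a section of $h$. The image of this section is exactly the locus in $\mathcal M_0(2,0)$ of the classes of stable co-Higgs bundles whose underlying bundle is isomorphic to $\mathcal O(1)\oplus\mathcal O(-1)$. Moreover, each trace-free Higgs field $\phi$ for $E^1_{-1}$ such that $(E^1_{-1},\phi)$ is stable is conjugate, by an automorphism of $E^1_{-1}$, to $Q(\rho)$ for exactly one $\rho$, namely $\rho=\det\phi$; thus two such fields are conjugate if and only if they have the same $-\det\phi\in H^0(\mathbb P^1;\mathcal O(4))$. -/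

import Mathlib

noncomputable section

namespace CoHiggsP1

open scoped Manifold ContDiff Topology Bundle
open Bundle OnePoint

/-- The complex projective line, as the Riemann sphere `ℂ ∪ {∞}`. -/
abbrev P1 : Type := OnePoint ℂ

/-- The affine coordinate `z` (with junk value `0` at `∞`). -/
def coord (x : P1) : ℂ := x.elim 0 id

/-- The involution `z ↦ 1/z` of the projective line, exchanging `0` and `∞`. -/
def inversion (x : P1) : P1 := x.elim ((0 : ℂ) : P1) (fun z => if z = 0 then (∞ : P1) else ((z⁻¹ : ℂ) : P1))

@[simp] lemma coord_coe (z : ℂ) : coord (z : P1) = z := rfl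

@[simp] lemma coord_infty : coord (∞ : P1) = 0 := rfl

lemma coord_inversion (x : P1) : coord (inversion x) = (coord x)⁻¹ := by
  induction x using OnePoint.rec with
  | infty => simp [inversion]
  | coe z => by_cases hz : z = 0 <;> simp [inversion, hz]

lemma inversion_inversion (x : P1) : inversion (inversion x) = x := by
  induction x using OnePoint.rec with
  | infty => simp [inversion]
  | coe z => by_cases hz : z = 0 <;> simp [inversion, hz]

lemma continuous_inversion : Continuous inversion := by
  rw [OnePoint.continuous_iff]
  constructor
  · have h : Filter.Tendsto (fun z : ℂ => ((z⁻¹ : ℂ) : P1)) (Filter.coclosedCompact ℂ)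
        (𝓝 ((0 : ℂ) : P1)) := by
      refine (OnePoint.continuous_coe.tendsto 0).comp ?_
      rw [Filter.coclosedCompact_eq_cocompact, ← Metric.cobounded_eq_cocompact]
      exact Filter.tendsto_inv₀_cobounded
    refine h.congr' ?_
    have : {(0 : ℂ)}ᶜ ∈ Filter.coclosedCompact ℂ := by
      rw [Filter.coclosedCompact_eq_cocompact]
      exact isCompact_singleton.compl_mem_cocompact
    filter_upwards [this] with z hz
    have hz' : z ≠ 0 := hz
    simp [inversion, hz']
  · rw [continuous_iff_continuousAt]
    intro z
    by_cases hz : z = 0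
    · subst hz
      rw [continuousAt_iff_punctured_nhds]
      have h : Filter.Tendsto (fun z : ℂ => ((z⁻¹ : ℂ) : P1)) (𝓝[≠] 0) (𝓝 (∞ : P1)) := by
        refine OnePoint.tendsto_coe_infty.comp ?_
        rw [Filter.coclosedCompact_eq_cocompact, ← Metric.cobounded_eq_cocompact]
        exact Filter.tendsto_inv₀_nhdsNE_zero
      have h0 : inversion ((0 : ℂ) : P1) = (∞ : P1) := by simp [inversion]
      rw [h0]
      refine h.congr' ?_
      filter_upwards [self_mem_nhdsWithin] with z hz
      have hz' : z ≠ 0 := hz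
      simp [inversion, hz']
    · have h : ContinuousAt (fun z : ℂ => ((z⁻¹ : ℂ) : P1)) z :=
        OnePoint.continuous_coe.continuousAt.comp (continuousAt_inv₀ hz)
      refine h.congr ?_
      filter_upwards [isOpen_ne.mem_nhds hz] with w hw
      have hw' : w ≠ 0 := hw
      simp [inversion, hw']

/-- The inversion as a homeomorphism. -/
def inversionHomeo : P1 ≃ₜ P1 where
  toFun := inversion
  invFun := inversion
  left_inv := inversion_inversion
  right_inv := inversion_inversion
  continuous_toFun := continuous_inversion
  continuous_invFun := continuous_inversion

/-- The chart `z` on the complement of `∞`. -/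
def affineChart : OpenPartialHomeomorph P1 ℂ where
  toFun := coord
  invFun := fun z => (z : P1)
  source := {(∞ : P1)}ᶜ
  target := Set.univ
  map_source' := fun _ _ => Set.mem_univ _
  map_target' := fun z _ => OnePoint.coe_ne_infty z
  left_inv' := fun x hx => by
    obtain ⟨z, rfl⟩ := OnePoint.ne_infty_iff_exists.1 hx
    rfl
  right_inv' := fun _ _ => rfl
  open_source := OnePoint.isClosed_infty.isOpen_compl
  open_target := isOpen_univ
  continuousOn_toFun := fun x hx => by
    obtain ⟨z, rfl⟩ := OnePoint.ne_infty_iff_exists.1 hx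
    have h : ContinuousAt (coord ∘ ((↑) : ℂ → P1)) z := continuousAt_id
    exact (OnePoint.continuousAt_coe.2 h).continuousWithinAt
  continuousOn_invFun := OnePoint.continuous_coe.continuousOn

/-- The chart `w = 1/z` on the complement of `0`. -/
def inftyChart : OpenPartialHomeomorph P1 ℂ :=
  inversionHomeo.toOpenPartialHomeomorph.trans affineChart

lemma inftyChart_apply (x : P1) : inftyChart x = (coord x)⁻¹ := coord_inversion x

lemma inftyChart_symm_apply (w : ℂ) : inftyChart.symm w = inversion (w : P1) := rfl

lemma inftyChart_source : inftyChart.source = {((0 : ℂ) : P1)}ᶜ := by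
  ext x
  have : x ∈ inftyChart.source ↔ inversion x ≠ (∞ : P1) := by
    simp [inftyChart, affineChart, inversionHomeo]
  rw [this]
  induction x using OnePoint.rec with
  | infty => simp [inversion]
  | coe z => by_cases hz : z = 0 <;> simp [inversion, hz]

/-- The charts `z` and `w = 1/z` of the projective line. -/
instance : ChartedSpace ℂ P1 where
  atlas := {affineChart, inftyChart}
  chartAt x := x.elim inftyChart (fun _ => affineChart)
  mem_chart_source x := by
    induction x using OnePoint.rec with
    | infty =>
      change (∞ : P1) ∈ inftyChart.source
      simp [inftyChart_source]
    | coe z => exact OnePoint.coe_ne_infty z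
  chart_mem_atlas x := by
    induction x using OnePoint.rec with
    | infty => right; rfl
    | coe z => left; rfl

lemma inftyChart_target : inftyChart.target = Set.univ := by
  simp [inftyChart, affineChart]

lemma contDiffOn_inv_compl : ContDiffOn ℂ ω (fun z : ℂ => z⁻¹) {(0 : ℂ)}ᶜ :=
  fun _ hz => (contDiffAt_inv ℂ hz).contDiffWithinAt

/-- The projective line is a complex manifold. -/
instance : IsManifold 𝓘(ℂ) ω P1 := by
  refine isManifold_of_contDiffOn _ _ _ ?_
  rintro e e' (rfl | rfl) (rfl | rfl)
  · refine contDiffOn_id.congr ?_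
    intro z hz; rfl
  · refine (contDiffOn_inv_compl.mono ?_).congr ?_
    · intro z hz h0
      have := hz.1.2
      simp [inftyChart_source, affineChart] at this
      exact this (congrArg ((↑) : ℂ → P1) h0)
    · intro z hz
      exact inftyChart_apply _
  · refine (contDiffOn_inv_compl.mono ?_).congr ?_
    · intro z hz h0
      have := hz.1.2
      have h0' : z = 0 := h0
      simp [affineChart, inftyChart_symm_apply, h0', inversion] at this
    · intro z _
      exact coord_inversion (z : P1)
  · refine contDiffOn_id.congr ?_
    intro z hz
    have : inftyChart (inftyChart.symm z) = z := inftyChart.right_inv (by simp [inftyChart_target])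
    exact this

lemma contMDiffOn_coord : ContMDiffOn 𝓘(ℂ) 𝓘(ℂ) ω coord {(∞ : P1)}ᶜ :=
  contMDiffOn_of_mem_maximalAtlas
    (IsManifold.subset_maximalAtlas (n := ω) (show affineChart ∈ atlas ℂ P1 from Or.inl rfl))

/-- The standard cover of the projective line: `false` indexes the complement of `∞`, and `true`
the complement of `0`. -/
def stdCover (i : Bool) : Set P1 := if i then {((0 : ℂ) : P1)}ᶜ else {(∞ : P1)}ᶜ

/-- A member of the standard cover that contains `x`: the complement of `∞` if `x ≠ ∞`. -/
def stdIndex (x : P1) : Bool := x.elim true (fun _ => false)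

/-- The transition function of `𝒪(1)` from the trivialization with index `i` to the one with
index `j`: it is `1/z` from the affine part to the neighbourhood of `∞`. -/
def stdTrans (i j : Bool) (x : P1) : ℂ :=
  match i, j with
  | false, true => (coord x)⁻¹
  | true, false => coord x
  | _, _ => 1

lemma isOpen_stdCover (i : Bool) : IsOpen (stdCover i) := by
  cases i
  · exact OnePoint.isClosed_infty.isOpen_compl
  · exact isClosed_singleton.isOpen_compl

lemma mem_stdCover_stdIndex (x : P1) : x ∈ stdCover (stdIndex x) := by
  induction x using OnePoint.rec with
  | infty => exact OnePoint.infty_ne_coe (0 : ℂ)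
  | coe z => exact OnePoint.coe_ne_infty z

lemma coord_ne_zero {x : P1} (h0 : x ∈ stdCover false) (h1 : x ∈ stdCover true) :
    coord x ≠ 0 := by
  obtain ⟨z, rfl⟩ := OnePoint.ne_infty_iff_exists.1 h0
  intro hz
  rw [coord_coe] at hz
  exact h1 (by rw [hz]; rfl)

lemma stdTrans_ne_zero {i j : Bool} {x : P1} (hi : x ∈ stdCover i) (hj : x ∈ stdCover j) :
    stdTrans i j x ≠ 0 := by
  cases i <;> cases j
  · exact one_ne_zero
  · exact inv_ne_zero (coord_ne_zero hi hj)
  · exact coord_ne_zero hj hi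
  · exact one_ne_zero

lemma stdTrans_self (i : Bool) (x : P1) : stdTrans i i x = 1 := by cases i <;> rfl

lemma stdTrans_comp {i j k : Bool} {x : P1} (hi : x ∈ stdCover i) (hj : x ∈ stdCover j)
    (hk : x ∈ stdCover k) : stdTrans j k x * stdTrans i j x = stdTrans i k x := by
  cases i <;> cases j <;> cases k <;> simp [stdTrans]
  · exact mul_inv_cancel₀ (coord_ne_zero hi hj)
  · exact inv_mul_cancel₀ (coord_ne_zero hj hi)

lemma contMDiffOn_stdTrans_zpow (i j : Bool) (n : ℤ) :
    ContMDiffOn 𝓘(ℂ) 𝓘(ℂ) ω (fun x => stdTrans i j x ^ n) (stdCover i ∩ stdCover j) := by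
  have hz : ∀ m : ℤ, ContMDiffOn 𝓘(ℂ) 𝓘(ℂ) ω (fun x => coord x ^ m)
      (stdCover false ∩ stdCover true) := by
    intro m x hx
    have h1 : ContDiffAt ℂ ω (fun z : ℂ => z ^ m) (coord x) :=
      (analyticAt_id.zpow (coord_ne_zero hx.1 hx.2)).contDiffAt
    exact h1.contMDiffAt.comp_contMDiffWithinAt x
      ((contMDiffOn_coord x hx.1).mono Set.inter_subset_left)
  cases i <;> cases j
  · simpa [stdTrans] using contMDiffOn_const
  · refine (hz (-n)).congr ?_
    intro x _
    simp [stdTrans]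
  · rw [Set.inter_comm]
    exact hz n
  · simpa [stdTrans] using contMDiffOn_const

/-- The line bundle `𝒪(n)`, given by the transition function `z ^ (-n)` on `ℂ ∖ {0}`: a section is
a pair of functions `s₀(z)`, `s₁(w)`, `w = 1/z`, with `s₁(1/z) = z ^ (-n) * s₀(z)`. The fibre at each
point is `ℂ`, through the trivialization with the index `stdIndex x`. -/
def lineCore (n : ℤ) : VectorBundleCore ℂ P1 ℂ Bool where
  baseSet := stdCover
  isOpen_baseSet := isOpen_stdCover
  indexAt := stdIndex
  mem_baseSet_at := mem_stdCover_stdIndex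
  coordChange i j x := (stdTrans i j x ^ n) • ContinuousLinearMap.id ℂ ℂ
  coordChange_self i x _ v := by simp [stdTrans_self]
  continuousOn_coordChange i j :=
    (contMDiffOn_stdTrans_zpow i j n).continuousOn.smul continuousOn_const
  coordChange_comp i j k x hx v := by
    simp [← stdTrans_comp hx.1.1 hx.1.2 hx.2, mul_zpow, mul_assoc]

/-- The vector bundle `𝒪(m 0) ⊕ ⋯ ⊕ 𝒪(m (r - 1))`. The fibre at each point is `ℂ ^ r`, whose `k`-th
component is the fibre of `𝒪(m k)` at that point. -/
def splitCore {r : ℕ} (m : Fin r → ℤ) : VectorBundleCore ℂ P1 (Fin r → ℂ) Bool where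
  baseSet := stdCover
  isOpen_baseSet := isOpen_stdCover
  indexAt := stdIndex
  mem_baseSet_at := mem_stdCover_stdIndex
  coordChange i j x := ContinuousLinearMap.pi fun k =>
    (stdTrans i j x ^ m k) • ContinuousLinearMap.proj (R := ℂ) (φ := fun _ : Fin r => ℂ) k
  coordChange_self i x _ v := by ext k; simp [stdTrans_self]
  continuousOn_coordChange i j := by
    refine continuousOn_clm_apply.2 fun v => ?_
    refine continuousOn_pi.2 fun k => ?_
    exact (contMDiffOn_stdTrans_zpow i j (m k)).continuousOn.smul continuousOn_const
  coordChange_comp i j k x hx v := by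
    ext l
    simp [← stdTrans_comp hx.1.1 hx.1.2 hx.2, mul_zpow, mul_assoc]

instance (n : ℤ) : (lineCore n).IsContMDiff 𝓘(ℂ) ω where
  contMDiffOn_coordChange i j :=
    (contMDiffOn_stdTrans_zpow i j n).smul contMDiffOn_const

instance {r : ℕ} (m : Fin r → ℤ) : (splitCore m).IsContMDiff 𝓘(ℂ) ω where
  contMDiffOn_coordChange i j := by
    have h : ∀ x, (splitCore m).coordChange i j x = ∑ k, (stdTrans i j x ^ m k) •
        (ContinuousLinearMap.single ℂ (fun _ : Fin r => ℂ) k ∘L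
          ContinuousLinearMap.proj (R := ℂ) (φ := fun _ : Fin r => ℂ) k) := by
      intro x
      ext v l
      simp [splitCore, Finset.sum_apply, Pi.single_apply]
    rw [show (splitCore m).coordChange i j = _ from funext h]
    exact contMDiffOn_finsetSum fun k _ =>
      (contMDiffOn_stdTrans_zpow i j (m k)).smul contMDiffOn_const

/-- The space of holomorphic sections of `𝒪(n)`. -/
abbrev H0 (n : ℤ) : Type := ContMDiffSection 𝓘(ℂ) ℂ ω (lineCore n).Fiber

/-- The complex number that represents an element of the fibre of `𝒪(n)` at `x`, in the
trivialization with index `stdIndex x`. This trivialization is used for all `n` at once, so that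
the product `𝒪(m)ₓ × 𝒪(n)ₓ → 𝒪(m + n)ₓ` is the multiplication of these numbers. -/
def lineVal {n : ℤ} {x : P1} (v : (lineCore n).Fiber x) : ℂ := v

/-- A holomorphic vector bundle of finite rank on the projective line. -/
structure HolBundle where
  /-- The rank. -/
  rank : ℕ
  /-- The fibres. -/
  Fiber : P1 → Type
  [addCommGroup : ∀ x, AddCommGroup (Fiber x)]
  [module : ∀ x, Module ℂ (Fiber x)]
  [topFiber : ∀ x, TopologicalSpace (Fiber x)]
  [topTotal : TopologicalSpace (TotalSpace (Fin rank → ℂ) Fiber)]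
  [fiberBundle : FiberBundle (Fin rank → ℂ) Fiber]
  [vectorBundle : VectorBundle ℂ (Fin rank → ℂ) Fiber]
  [holomorphic : ContMDiffVectorBundle ω (Fin rank → ℂ) Fiber 𝓘(ℂ)]

attribute [instance] HolBundle.addCommGroup HolBundle.module HolBundle.topFiber
  HolBundle.topTotal HolBundle.fiberBundle HolBundle.vectorBundle HolBundle.holomorphic

/-- The holomorphic vector bundle `𝒪(m 0) ⊕ ⋯ ⊕ 𝒪(m (r - 1))`. -/
def splitBundle {r : ℕ} (m : Fin r → ℤ) : HolBundle where
  rank := r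
  Fiber := (splitCore m).Fiber

/-- A morphism of holomorphic vector bundles: a fibrewise linear map that is holomorphic as a map
of total spaces. -/
structure BundleHom (E F : HolBundle) where
  /-- The linear maps on fibres. -/
  app : ∀ x, E.Fiber x →ₗ[ℂ] F.Fiber x
  holo : ContMDiff (𝓘(ℂ).prod 𝓘(ℂ, Fin E.rank → ℂ)) (𝓘(ℂ).prod 𝓘(ℂ, Fin F.rank → ℂ)) ω
    (fun p : TotalSpace (Fin E.rank → ℂ) E.Fiber =>
      (⟨p.1, app p.1 p.2⟩ : TotalSpace (Fin F.rank → ℂ) F.Fiber))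

/-- Isomorphism of holomorphic vector bundles. -/
def BundleIso (E F : HolBundle) : Prop :=
  ∃ (f : BundleHom E F) (g : BundleHom F E),
    (∀ x v, g.app x (f.app x v) = v) ∧ ∀ x v, f.app x (g.app x v) = v

/-- `E` has degree `d`: `E` is isomorphic to a sum of line bundles `𝒪(mᵢ)` with `∑ mᵢ = d`.
(By the Birkhoff–Grothendieck theorem each `E` is such a sum, and the `mᵢ` are unique up to
order, so that each `E` has exactly one degree.) -/
def HasDegree (E : HolBundle) (d : ℤ) : Prop :=
  ∃ m : Fin E.rank → ℤ, BundleIso E (splitBundle m) ∧ ∑ k, m k = d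

/-- A Higgs field for `E`, that is, a holomorphic section `φ` of `End E ⊗ 𝒪(2)`, where
`𝒪(2) = K*`. As `𝒪(2)` is the dual of `K = 𝒪(-2)`, the field is given by a holomorphic map
`K × E → E` over the projective line, bilinear on the fibres. -/
structure HiggsField (E : HolBundle) where
  /-- The bilinear maps `Kₓ × Eₓ → Eₓ`. -/
  app : ∀ x, (lineCore (-2)).Fiber x →ₗ[ℂ] E.Fiber x →ₗ[ℂ] E.Fiber x
  holo : ContMDiff (𝓘(ℂ).prod 𝓘(ℂ, ℂ × (Fin E.rank → ℂ))) (𝓘(ℂ).prod 𝓘(ℂ, Fin E.rank → ℂ)) ω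
    (fun p : TotalSpace (ℂ × (Fin E.rank → ℂ)) ((lineCore (-2)).Fiber ×ᵇ E.Fiber) =>
      (⟨p.1, app p.1 p.2.1 p.2.2⟩ : TotalSpace (Fin E.rank → ℂ) E.Fiber))

/-- A co-Higgs bundle `(E, φ)` on the projective line. -/
structure CoHiggs where
  /-- The underlying bundle. -/
  bundle : HolBundle
  /-- The Higgs field. -/
  field : HiggsField bundle

/-- A morphism of bundles commutes with the Higgs fields of two co-Higgs bundles. -/
def Commutes {c c' : CoHiggs} (f : BundleHom c.bundle c'.bundle) : Prop :=
  ∀ x k v, f.app x (c.field.app x k v) = c'.field.app x k (f.app x v)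

/-- A morphism of co-Higgs bundles. -/
structure CoHiggsHom (c c' : CoHiggs) extends BundleHom c.bundle c'.bundle where
  comm : Commutes toBundleHom

/-- Isomorphism of co-Higgs bundles. -/
def CoHiggsIso (c c' : CoHiggs) : Prop :=
  ∃ (f : CoHiggsHom c c') (g : CoHiggsHom c' c),
    (∀ x v, g.app x (f.app x v) = v) ∧ ∀ x v, f.app x (g.app x v) = v

/-- Two Higgs fields for `E` are conjugate: `ψ φ ψ⁻¹ = φ'` for an automorphism `ψ` of `E`. -/
def Conjugate {E : HolBundle} (φ φ' : HiggsField E) : Prop :=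
  ∃ ψ ψ' : BundleHom E E, (∀ x v, ψ'.app x (ψ.app x v) = v) ∧
    (∀ x v, ψ.app x (ψ'.app x v) = v) ∧
    ∀ x k v, ψ.app x (φ.app x k (ψ'.app x v)) = φ'.app x k v

/-- `ι : U → E` embeds `U` as a proper nonzero subbundle of the underlying bundle of `c`, which is
invariant under the Higgs field. -/
structure IsInvariantSubbundle (c : CoHiggs) (U : HolBundle) (ι : BundleHom U c.bundle) :
    Prop where
  injective : ∀ x, Function.Injective (ι.app x)
  rank_pos : 0 < U.rank
  rank_lt : U.rank < c.bundle.rank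
  invariant : ∀ x k u, ∃ u', c.field.app x k (ι.app x u) = ι.app x u'

/-- Slope-stability of a co-Higgs bundle; `d / rk U < e / rk E`, with denominators cleared. -/
def IsStable (c : CoHiggs) : Prop :=
  0 < c.bundle.rank ∧ ∀ (U : HolBundle) (ι : BundleHom U c.bundle), IsInvariantSubbundle c U ι →
    ∀ d e : ℤ, HasDegree U d → HasDegree c.bundle e → d * c.bundle.rank < e * U.rank

/-- Slope-semistability of a co-Higgs bundle. -/
def IsSemistable (c : CoHiggs) : Prop :=
  0 < c.bundle.rank ∧ ∀ (U : HolBundle) (ι : BundleHom U c.bundle), IsInvariantSubbundle c U ι →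
    ∀ d e : ℤ, HasDegree U d → HasDegree c.bundle e → d * c.bundle.rank ≤ e * U.rank

/-- Two bundles have the same slope. -/
def SameSlope (E F : HolBundle) : Prop :=
  ∃ d e : ℤ, HasDegree E d ∧ HasDegree F e ∧ d * F.rank = e * E.rank

/-- `0 → A → E → B → 0` is a short exact sequence of co-Higgs bundles for some maps. -/
def IsExtension (A E B : CoHiggs) : Prop :=
  ∃ (i : CoHiggsHom A E) (p : CoHiggsHom E B), ∀ x, Function.Injective (i.app x) ∧
    Function.Surjective (p.app x) ∧ LinearMap.range (i.app x) = LinearMap.ker (p.app x)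

/-- `G` is isomorphic to the direct sum of the co-Higgs bundles `A` and `B`. -/
def IsDirectSum (A B G : CoHiggs) : Prop :=
  ∃ (i : CoHiggsHom A G) (j : CoHiggsHom B G) (p : CoHiggsHom G A) (q : CoHiggsHom G B),
    (∀ x v, p.app x (i.app x v) = v) ∧ (∀ x v, q.app x (j.app x v) = v) ∧
      ∀ x v, i.app x (p.app x v) + j.app x (q.app x v) = v

/-- `G` is isomorphic to the associated graded object `⨁ Eⱼ / Eⱼ₋₁` of a Jordan–Hölder filtration
`0 = E₀ ⊂ E₁ ⊂ ⋯ ⊂ Eₘ = E` of the co-Higgs bundle `E`: the `Eⱼ` are semistable, and the `Eⱼ / Eⱼ₋₁`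
are stable of the same slope as `E`. The filtration is built up one step at a time, from
`A = Eⱼ₋₁` to `E = Eⱼ`. -/
inductive IsGraded : CoHiggs → CoHiggs → Prop
  | stable {E G : CoHiggs} : IsStable E → CoHiggsIso E G → IsGraded E G
  | extend {A E B H G : CoHiggs} : IsSemistable A → IsSemistable E → IsStable B →
      IsExtension A E B → SameSlope A.bundle E.bundle → SameSlope B.bundle E.bundle →
      IsGraded A H → IsDirectSum H B G → IsGraded E G

/-- S-equivalence: the associated graded objects are isomorphic. -/
def SEquivalent (c c' : CoHiggs) : Prop :=
  ∃ G, IsGraded c G ∧ IsGraded c' G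

/-- The Higgs field has trace zero. -/
def TraceFree {E : HolBundle} (φ : HiggsField E) : Prop :=
  ∀ x k, LinearMap.trace ℂ (E.Fiber x) (φ.app x k) = 0

/-- The semistable trace-free co-Higgs bundles of rank `r` and degree `d`. -/
structure IsModuliObject (r : ℕ) (d : ℤ) (c : CoHiggs) : Prop where
  rank_eq : c.bundle.rank = r
  degree : HasDegree c.bundle d
  traceFree : TraceFree c.field
  semistable : IsSemistable c

/-- The (closed points of the) moduli space `M₀(r, d)`: the S-equivalence classes of semistable
trace-free co-Higgs bundles of rank `r` and degree `d` on the projective line. -/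
def M0 (r : ℕ) (d : ℤ) : Type 1 :=
  Quot fun c c' : {c : CoHiggs // IsModuliObject r d c} => SEquivalent c.1 c'.1

/-- The point of the moduli space that a co-Higgs bundle represents. -/
def M0.mk {r : ℕ} {d : ℤ} (c : CoHiggs) (hc : IsModuliObject r d c) : M0 r d :=
  Quot.mk _ ⟨c, hc⟩

/-- The locus in the moduli space of the stable co-Higgs bundles with underlying bundle isomorphic
to `E`. -/
def stableLocus {r : ℕ} {d : ℤ} (E : HolBundle) : Set (M0 r d) :=
  {p | ∃ (c : CoHiggs) (hc : IsModuliObject r d c),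
    IsStable c ∧ BundleIso c.bundle E ∧ M0.mk c hc = p}

/-- The section `ρ` of `𝒪(4)` is the determinant of the Higgs field `φ` (on a bundle of rank 2):
`det φₓ(k) = ρₓ k²` for `k` in the fibre of `K = 𝒪(-2)` at `x`. -/
def HasDet {E : HolBundle} (φ : HiggsField E) (ρ : H0 4) : Prop :=
  ∀ x k, LinearMap.det (φ.app x k) = lineVal (ρ x) * lineVal k ^ 2

/-- The Hitchin map takes the value `ρ` at the point `p` of `M₀(2, 0)`: the constant coefficient
`det φ` of the characteristic polynomial `η² + det φ` of each trace-free Higgs field `φ` that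
represents `p` is `ρ`. -/
def HitchinMapsTo (p : M0 2 0) (ρ : H0 4) : Prop :=
  ∀ (c : CoHiggs) (hc : IsModuliObject 2 0 c), M0.mk c hc = p → HasDet c.field ρ

/-- The bundle `𝒪(1) ⊕ 𝒪(-1)`. -/
abbrev E11 : HolBundle := splitBundle ![1, -1]

/-- The linear map with matrix `!![0, -a; 1, 0]`, multiplied by `k`. -/
def qMap (a : ℂ) : ℂ →ₗ[ℂ] (Fin 2 → ℂ) →ₗ[ℂ] (Fin 2 → ℂ) :=
  LinearMap.toSpanSingleton ℂ _ (Matrix.toLin' !![0, -a; 1, 0])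

lemma qMap_apply (a k : ℂ) (v : Fin 2 → ℂ) : qMap a k v = ![-a * k * v 1, k * v 0] := by
  ext i
  fin_cases i
  · simp [qMap, dotProduct, Fin.sum_univ_two]
    ring
  · simp [qMap, dotProduct, Fin.sum_univ_two]

lemma qMap_transition_zero {t : ℂ} (ht : t ≠ 0) (a k : ℂ) (v : Fin 2 → ℂ) :
    t ^ (1 : ℤ) * qMap a k v 0 =
      -(t ^ (4 : ℤ) * a * (t ^ (-2 : ℤ) * k) * (t ^ (-1 : ℤ) * v 1)) := by
  have h : t ^ (4 : ℤ) * t ^ (-2 : ℤ) * t ^ (-1 : ℤ) = t ^ (1 : ℤ) := by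
    rw [← zpow_add₀ ht, ← zpow_add₀ ht]
    norm_num
  rw [qMap_apply, ← h]
  simp only [Matrix.cons_val_zero]
  ring

lemma qMap_transition_one {t : ℂ} (ht : t ≠ 0) (a k : ℂ) (v : Fin 2 → ℂ) :
    t ^ (-1 : ℤ) * qMap a k v 1 = t ^ (-2 : ℤ) * k * (t ^ (1 : ℤ) * v 0) := by
  have h : t ^ (-2 : ℤ) * t ^ (1 : ℤ) = t ^ (-1 : ℤ) := by
    rw [← zpow_add₀ ht]
    norm_num
  rw [qMap_apply, ← h]
  simp only [Matrix.cons_val_one, Matrix.cons_val_fin_one]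
  ring

lemma contMDiff_qMap (ρ : H0 4) :
    ContMDiff (𝓘(ℂ).prod 𝓘(ℂ, ℂ × (Fin 2 → ℂ))) (𝓘(ℂ).prod 𝓘(ℂ, Fin 2 → ℂ)) ω
      (fun p : TotalSpace (ℂ × (Fin 2 → ℂ))
          ((lineCore (-2)).Fiber ×ᵇ (splitCore ![1, -1]).Fiber) =>
        (⟨p.1, qMap (lineVal (ρ p.1)) p.2.1 p.2.2⟩ :
          TotalSpace (Fin 2 → ℂ) (splitCore ![1, -1]).Fiber)) := by
  intro p₀
  have hid : ContMDiffAt (𝓘(ℂ).prod 𝓘(ℂ, ℂ × (Fin 2 → ℂ))) (𝓘(ℂ).prod 𝓘(ℂ, ℂ × (Fin 2 → ℂ))) ω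
      (id : TotalSpace (ℂ × (Fin 2 → ℂ)) ((lineCore (-2)).Fiber ×ᵇ (splitCore ![1, -1]).Fiber) →
        TotalSpace (ℂ × (Fin 2 → ℂ)) ((lineCore (-2)).Fiber ×ᵇ (splitCore ![1, -1]).Fiber))
      p₀ := contMDiffAt_id
  obtain ⟨hπ, hv⟩ := Bundle.contMDiffAt_totalSpace.1 hid
  have hk := (contDiff_fst (𝕜 := ℂ) (E := ℂ) (F := Fin 2 → ℂ) (n := ω)).contMDiff.contMDiffAt.comp
    p₀ hv
  have hs := (contDiff_snd (𝕜 := ℂ) (E := ℂ) (F := Fin 2 → ℂ) (n := ω)).contMDiff.contMDiffAt.comp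
    p₀ hv
  have hv0 := (contMDiffAt_pi_space.1 hs) 0
  have hv1 := (contMDiffAt_pi_space.1 hs) 1
  have hρ := ContMDiffAt.comp p₀ ((Bundle.contMDiffAt_section p₀.1).1 (ρ.contMDiff p₀.1)) hπ
  have hev : ∀ᶠ p in 𝓝 p₀, stdTrans (stdIndex p.1) (stdIndex p₀.1) p.1 ≠ 0 := by
    have hmem := hπ.continuousAt.preimage_mem_nhds
      ((isOpen_stdCover (stdIndex p₀.1)).mem_nhds (mem_stdCover_stdIndex p₀.1))
    filter_upwards [hmem] with p hp
    exact stdTrans_ne_zero (mem_stdCover_stdIndex p.1) hp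
  refine Bundle.contMDiffAt_totalSpace.2 ⟨hπ, ?_⟩
  refine contMDiffAt_pi_space.2 fun i => ?_
  fin_cases i
  · refine ((hρ.mul hk).mul hv1).neg.congr_of_eventuallyEq ?_
    filter_upwards [hev] with p hp
    exact qMap_transition_zero hp _ _ _
  · refine (hk.mul hv0).congr_of_eventuallyEq ?_
    filter_upwards [hev] with p hp
    exact qMap_transition_one hp _ _ _

/-- The Higgs field `Q(ρ) = !![0, -ρ; 1, 0]` for `𝒪(1) ⊕ 𝒪(-1)`. -/
def Qfield (ρ : H0 4) : HiggsField E11 where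
  app x := qMap (lineVal (ρ x))
  holo := contMDiff_qMap ρ

/-- The co-Higgs bundle `(𝒪(1) ⊕ 𝒪(-1), Q(ρ))`. -/
def Q (ρ : H0 4) : CoHiggs := ⟨E11, Qfield ρ⟩

end CoHiggsP1

end

open CoHiggsP1

noncomputable section

namespace CoHiggsP1

open scoped Manifold ContDiff Topology Bundle
open Bundle OnePoint

/-! In matrix form a trace-free Higgs field on `𝒪(1) ⊕ 𝒪(-1)` is `!![a, b; c, -a]`, with `a`, `b`,
`c` sections of `𝒪(2)`, `𝒪(4)`, `𝒪(0)`. By Liouville, sections of `𝒪` are constant and those of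
negative degree vanish, so `c` is a constant.

Stability is equivalent to `c ≠ 0`. If `c = 0`, then `𝒪(1)` is invariant and destabilizes
(`IsStable.entry_ne_zero`). If `c` never vanishes, an invariant line subbundle of degree `≥ 0` would
have to lie in `𝒪(1)`, because its component in `𝒪(-1)` is a section of negative degree; invariance
then forces `c = 0` (`isStable_of_entry_ne_zero`).

If `c ≠ 0`, the automorphism `!![c, -a; 0, 1]` conjugates the field to the companion matrix of its
characteristic polynomial (`conjugate_Qfield`). Hence the determinant is a complete invariant.

The determinant is multiplicative on extensions, so it agrees with that of the associated graded
object and is constant on S-equivalence classes (`IsGraded.det_eq`, `det_eq_of_mk_eq`). Conversely,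
isomorphic stable objects are S-equivalent, which identifies the image of the section with the
stable locus. -/

/-! ### Holomorphic sections of line bundles -/

/-- The function `s`, which gives the value at `x` in the trivialization with index `stdIndex x`,
is a holomorphic section of `𝒪(n)`. -/
def IsHolSection (n : ℤ) (s : P1 → ℂ) : Prop :=
  ∀ x₀, ContMDiffAt 𝓘(ℂ) 𝓘(ℂ) ω
    (fun x => stdTrans (stdIndex x) (stdIndex x₀) x ^ n * s x) x₀

/-- Adding integer exponents of the transition function requires a nonzero base; holomorphy at `x₀`
only needs this nearby. -/
lemma eventually_stdTrans_ne_zero (x₀ : P1) :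
    ∀ᶠ x in 𝓝 x₀, stdTrans (stdIndex x) (stdIndex x₀) x ≠ 0 := by
  filter_upwards [(isOpen_stdCover (stdIndex x₀)).mem_nhds (mem_stdCover_stdIndex x₀)] with x hx
  exact stdTrans_ne_zero (mem_stdCover_stdIndex x) hx

lemma contMDiff_coe_P1 : ContMDiff 𝓘(ℂ) 𝓘(ℂ) ω ((↑) : ℂ → P1) := by
  rw [← contMDiffOn_univ]
  exact contMDiffOn_symm_of_mem_maximalAtlas
    (IsManifold.subset_maximalAtlas (n := ω) (show affineChart ∈ atlas ℂ P1 from Or.inl rfl))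

lemma H0_ext {n : ℤ} {s t : H0 n} (h : ∀ x, lineVal (s x) = lineVal (t x)) : s = t :=
  ContMDiffSection.ext h

namespace IsHolSection

variable {m n : ℤ} {s t : P1 → ℂ}

/-- The element of `H⁰(𝒪(n))` given by a holomorphic section. -/
def toH0 (h : IsHolSection n s) : H0 n where
  toFun x := s x
  contMDiff_toFun x₀ := (Bundle.contMDiffAt_section x₀).2 (h x₀)

lemma congr (h : IsHolSection n s) (hmn : m = n) (hst : ∀ x, t x = s x) : IsHolSection m t := by
  obtain rfl : t = s := funext hst
  exact hmn ▸ h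

lemma mul (hs : IsHolSection m s) (ht : IsHolSection n t) :
    IsHolSection (m + n) fun x => s x * t x := by
  intro x₀
  refine ((hs x₀).mul (ht x₀)).congr_of_eventuallyEq ?_
  filter_upwards [eventually_stdTrans_ne_zero x₀] with x hx
  simp only [zpow_add₀ hx, Pi.mul_apply]
  ring

lemma add (hs : IsHolSection n s) (ht : IsHolSection n t) :
    IsHolSection n fun x => s x + t x := by
  intro x₀
  refine ((hs x₀).add (ht x₀)).congr_of_eventuallyEq (.of_forall fun x => ?_)
  simp only [Pi.add_apply]
  ring

lemma neg (hs : IsHolSection n s) : IsHolSection n fun x => -s x := by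
  intro x₀
  refine (hs x₀).neg.congr_of_eventuallyEq (.of_forall fun x => ?_)
  exact mul_neg _ _

lemma sub (hs : IsHolSection n s) (ht : IsHolSection n t) :
    IsHolSection n fun x => s x - t x :=
  (hs.add ht.neg).congr rfl fun _ => sub_eq_add_neg _ _

lemma inv (hs : IsHolSection n s) (h0 : ∀ x, s x ≠ 0) :
    IsHolSection (-n) fun x => (s x)⁻¹ := by
  intro x₀
  have hne : stdTrans (stdIndex x₀) (stdIndex x₀) x₀ ^ n * s x₀ ≠ 0 := by
    rw [stdTrans_self, one_zpow, one_mul]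
    exact h0 x₀
  refine ((contDiffAt_inv ℂ hne).contMDiffAt.comp x₀ (hs x₀)).congr_of_eventuallyEq
    (.of_forall fun x => ?_)
  simp [mul_comm]

lemma _root_.CoHiggsP1.isHolSection_const (c : ℂ) : IsHolSection 0 fun _ => c := by
  intro x₀
  simpa using contMDiffAt_const

lemma _root_.CoHiggsP1.isHolSection_zero (n : ℤ) : IsHolSection n fun _ => 0 := by
  intro x₀
  simpa using contMDiffAt_const

lemma differentiable (hs : IsHolSection n s) : Differentiable ℂ fun z : ℂ => s z := by
  intro z
  have h := (hs (z : P1)).comp z (contMDiff_coe_P1 z)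
  have h' : ContMDiffAt 𝓘(ℂ) 𝓘(ℂ) ω (fun z : ℂ => s z) z := by
    refine h.congr_of_eventuallyEq (.of_forall fun w => ?_)
    change s w = stdTrans false false (w : P1) ^ n * s w
    simp [stdTrans_self]
  exact h'.contDiffAt.differentiableAt (by simp)

/-- Continuity at `∞` in the chart there is a growth condition on the affine function: the
transition function from the affine part is `z⁻¹`. -/
lemma tendsto_infty (hs : IsHolSection n s) :
    Filter.Tendsto (fun z : ℂ => z⁻¹ ^ n * s z) (Filter.cocompact ℂ) (𝓝 (s ∞)) := by
  have h := (hs ∞).continuousAt.tendsto.comp OnePoint.tendsto_coe_infty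
  rw [Filter.coclosedCompact_eq_cocompact] at h
  rw [stdTrans_self, one_zpow, one_mul] at h
  exact h

/-- A holomorphic section of `𝒪` is constant. -/
lemma eq_const (hs : IsHolSection 0 s) (x : P1) : s x = s ∞ := by
  induction x using OnePoint.rec with
  | infty => rfl
  | coe z =>
    -- Liouville: an entire function with a finite limit at infinity equals that limit.
    exact hs.differentiable.apply_eq_of_tendsto_cocompact z (by simpa using hs.tendsto_infty)

/-- A line bundle of negative degree has no nonzero holomorphic section. -/
lemma eq_zero_of_neg (hs : IsHolSection n s) (hn : n < 0) (x : P1) : s x = 0 := by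
  obtain ⟨k, rfl⟩ : ∃ k : ℕ, n = -((k : ℤ) + 1) := ⟨(-n - 1).toNat, by omega⟩
  have hinv : Filter.Tendsto (fun z : ℂ => z⁻¹ ^ (k + 1)) (Filter.cocompact ℂ) (𝓝 0) := by
    rw [← Metric.cobounded_eq_cocompact]
    simpa using (Filter.tendsto_inv₀_cobounded (α := ℂ)).pow (k + 1)
  have hz : ∀ z : ℂ, s z = 0 := by
    intro z
    -- With `n = -(k + 1)`, the product `z ^ (k + 1) * s z` has a finite limit, so `s z` tends to
    -- `0` and Liouville applies.
    refine hs.differentiable.apply_eq_of_tendsto_cocompact z ?_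
    have h := hinv.mul hs.tendsto_infty
    rw [zero_mul] at h
    refine h.congr' ?_
    filter_upwards [(isCompact_singleton (x := (0 : ℂ))).compl_mem_cocompact] with w hw
    have hw : w ≠ 0 := hw
    rw [zpow_neg, ← mul_assoc, ← Nat.cast_succ, zpow_natCast, mul_inv_cancel₀ (by simp [hw]),
      one_mul]
  induction x using OnePoint.rec with
  | infty =>
    refine tendsto_nhds_unique hs.tendsto_infty ?_
    simp [hz]
  | coe z => exact hz z

/-- Only the trivial line bundle has a nowhere vanishing holomorphic section. -/
lemma degree_eq_zero (hs : IsHolSection n s) (h0 : ∀ x, s x ≠ 0) : n = 0 := by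
  rcases lt_trichotomy n 0 with h | h | h
  · exact absurd (hs.eq_zero_of_neg h ∞) (h0 ∞)
  · exact h
  · exact absurd ((hs.inv h0).eq_zero_of_neg (by omega) ∞) (inv_ne_zero (h0 ∞))

end IsHolSection

/-! ### Morphisms of bundles -/

namespace BundleHom

/-- The identity morphism. -/
def refl (E : HolBundle) : BundleHom E E where
  app _ := LinearMap.id
  holo := contMDiff_id

/-- The composition of two morphisms. -/
def comp {E F G : HolBundle} (g : BundleHom F G) (f : BundleHom E F) : BundleHom E G where
  app x := g.app x ∘ₗ f.app x
  holo := g.holo.comp f.holo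

end BundleHom

lemma BundleIso.refl (E : HolBundle) : BundleIso E E :=
  ⟨.refl E, .refl E, fun _ _ => rfl, fun _ _ => rfl⟩

lemma BundleIso.trans {E F G : HolBundle} : BundleIso E F → BundleIso F G → BundleIso E G :=
  fun ⟨f, g, h, h'⟩ ⟨f', g', k, k'⟩ => ⟨f'.comp f, g.comp g',
    fun x v => by simp [BundleHom.comp, k, h], fun x v => by simp [BundleHom.comp, k', h']⟩

/-- The coordinates of a vector in a fibre of `𝒪(m 0) ⊕ ⋯ ⊕ 𝒪(m (r - 1))`, in the trivialization
with index `stdIndex x`. -/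
def splitFiber {r : ℕ} (m : Fin r → ℤ) (x : P1) (v : Fin r → ℂ) : (splitCore m).Fiber x := v

/-- The element of the fibre of `𝒪(n)` at `x` with the given coordinate. -/
def lineFiber (n : ℤ) (x : P1) (c : ℂ) : (lineCore n).Fiber x := c

/-- A local frame of a split bundle, constant in the trivialization around `x₀`. -/
lemma contMDiffAt_splitFrame {r : ℕ} (m : Fin r → ℤ) (k : Fin r) (x₀ : P1) :
    ContMDiffAt 𝓘(ℂ) (𝓘(ℂ).prod 𝓘(ℂ, Fin r → ℂ)) ω
      (fun x => (⟨x, splitFiber m x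
        (stdTrans (stdIndex x) (stdIndex x₀) x ^ (-m k) • Pi.single k 1)⟩ :
          TotalSpace (Fin r → ℂ) (splitCore m).Fiber)) x₀ := by
  refine (Bundle.contMDiffAt_section x₀).2 (contMDiffAt_pi_space.2 fun i => ?_)
  have hc : ContMDiffAt 𝓘(ℂ) 𝓘(ℂ) ω (fun _ : P1 => (Pi.single k (1 : ℂ) : Fin r → ℂ) i) x₀ :=
    contMDiffAt_const
  refine hc.congr_of_eventuallyEq ?_
  filter_upwards [eventually_stdTrans_ne_zero x₀] with x hx
  change stdTrans (stdIndex x) (stdIndex x₀) x ^ m i *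
    (stdTrans (stdIndex x) (stdIndex x₀) x ^ (-m k) * (Pi.single k (1 : ℂ) : Fin r → ℂ) i) = _
  by_cases h : i = k
  · subst h
    rw [← mul_assoc, ← zpow_add₀ hx]
    simp
  · simp [h]

/-- The entry in the row `l` and the column `k` of a linear map between coordinate spaces. -/
def entry {r r' : ℕ} (f : (Fin r → ℂ) →ₗ[ℂ] (Fin r' → ℂ)) (l : Fin r') (k : Fin r) : ℂ :=
  f (Pi.single k 1) l

lemma apply_eq_sum_entry {r r' : ℕ} (f : (Fin r → ℂ) →ₗ[ℂ] (Fin r' → ℂ)) (v : Fin r → ℂ)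
    (l : Fin r') : f v l = ∑ k, entry f l k * v k := by
  conv_lhs => rw [pi_eq_sum_univ' v]
  simp [entry, Finset.sum_apply, mul_comm]

/-- The linear map on the fibre at `x` of a morphism of split bundles, in coordinates. -/
def BundleHom.coordMap {r r' : ℕ} {m : Fin r → ℤ} {n : Fin r' → ℤ}
    (f : BundleHom (splitBundle m) (splitBundle n)) (x : P1) :
    (Fin r → ℂ) →ₗ[ℂ] (Fin r' → ℂ) := f.app x

lemma BundleHom.contMDiff_coordMap {r r' : ℕ} {m : Fin r → ℤ} {n : Fin r' → ℤ}
    (f : BundleHom (splitBundle m) (splitBundle n)) :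
    ContMDiff (𝓘(ℂ).prod 𝓘(ℂ, Fin r → ℂ)) (𝓘(ℂ).prod 𝓘(ℂ, Fin r' → ℂ)) ω
      (fun p : TotalSpace (Fin r → ℂ) (splitCore m).Fiber =>
        (⟨p.1, f.coordMap p.1 p.2⟩ : TotalSpace (Fin r' → ℂ) (splitCore n).Fiber)) := f.holo

/-- The entries of a morphism of split bundles are holomorphic sections of line bundles. -/
lemma BundleHom.isHolSection_entry {r r' : ℕ} {m : Fin r → ℤ} {n : Fin r' → ℤ}
    (f : BundleHom (splitBundle m) (splitBundle n)) (l : Fin r') (k : Fin r) :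
    IsHolSection (n l - m k) fun x => entry (f.coordMap x) l k := by
  intro x₀
  -- Apply `f` to a local frame vector: the frame contributes the exponent `-m k`, and reading the
  -- row `l` near `x₀` contributes `n l`.
  have h := (f.contMDiff_coordMap _).comp x₀ (contMDiffAt_splitFrame m k x₀)
  have h' := (contMDiffAt_pi_space.1 (Bundle.contMDiffAt_totalSpace.1 h).2) l
  refine h'.congr_of_eventuallyEq ?_
  filter_upwards [eventually_stdTrans_ne_zero x₀] with x hx
  change _ = stdTrans (stdIndex x) (stdIndex x₀) x ^ n l *
    (f.coordMap x (stdTrans (stdIndex x) (stdIndex x₀) x ^ (-m k) • Pi.single k 1)) l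
  rw [_root_.map_smul, sub_eq_add_neg, zpow_add₀ hx]
  simp [entry, mul_assoc]

/-- Converse of `BundleHom.isHolSection_entry`: the transition factor with exponent `n l` splits
into `n l - m k` for the entry and `m k` for the coordinate. -/
lemma contMDiff_toLin' {r r' : ℕ} {m : Fin r → ℤ} {n : Fin r' → ℤ}
    (A : P1 → Matrix (Fin r') (Fin r) ℂ)
    (hA : ∀ l k, IsHolSection (n l - m k) fun x => A x l k) :
    ContMDiff (𝓘(ℂ).prod 𝓘(ℂ, Fin r → ℂ)) (𝓘(ℂ).prod 𝓘(ℂ, Fin r' → ℂ)) ω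
      (fun p : TotalSpace (Fin r → ℂ) (splitCore m).Fiber =>
        (⟨p.1, Matrix.toLin' (A p.1) p.2⟩ : TotalSpace (Fin r' → ℂ) (splitCore n).Fiber)) := by
  intro p₀
  have hid : ContMDiffAt (𝓘(ℂ).prod 𝓘(ℂ, Fin r → ℂ)) (𝓘(ℂ).prod 𝓘(ℂ, Fin r → ℂ)) ω
      (id : TotalSpace (Fin r → ℂ) (splitCore m).Fiber →
        TotalSpace (Fin r → ℂ) (splitCore m).Fiber) p₀ := contMDiffAt_id
  obtain ⟨hπ, hv⟩ := Bundle.contMDiffAt_totalSpace.1 hid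
  refine Bundle.contMDiffAt_totalSpace.2 ⟨hπ, contMDiffAt_pi_space.2 fun l => ?_⟩
  have hsum := contMDiffAt_finsetSum (t := Finset.univ) fun (k : Fin r) _ =>
    (ContMDiffAt.comp p₀ (hA l k p₀.1) hπ).mul ((contMDiffAt_pi_space.1 hv) k)
  refine hsum.congr_of_eventuallyEq ?_
  filter_upwards [hπ.continuousAt.eventually (eventually_stdTrans_ne_zero p₀.1)] with p hp
  change stdTrans (stdIndex p.1) (stdIndex p₀.1) p.1 ^ n l *
    (A p.1).mulVec (splitFiber m p.1 p.2) l = ∑ k,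
      (stdTrans (stdIndex p.1) (stdIndex p₀.1) p.1 ^ (n l - m k) * A p.1 l k) *
        (stdTrans (stdIndex p.1) (stdIndex p₀.1) p.1 ^ m k * splitFiber m p.1 p.2 k)
  simp only [Matrix.mulVec, dotProduct, Finset.mul_sum]
  refine Finset.sum_congr rfl fun k _ => ?_
  have hp' : stdTrans (stdIndex p.1) (stdIndex p₀.1) p.1 ≠ 0 := hp
  have hmul : stdTrans (stdIndex p.1) (stdIndex p₀.1) p.1 ^ n l =
      stdTrans (stdIndex p.1) (stdIndex p₀.1) p.1 ^ (n l - m k) *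
        stdTrans (stdIndex p.1) (stdIndex p₀.1) p.1 ^ m k := by
    rw [← zpow_add₀ hp', sub_add_cancel]
  rw [hmul]
  ring

/-- The morphism of split bundles whose entries are given holomorphic sections. -/
def BundleHom.ofMatrix {r r' : ℕ} {m : Fin r → ℤ} {n : Fin r' → ℤ}
    (A : P1 → Matrix (Fin r') (Fin r) ℂ)
    (hA : ∀ l k, IsHolSection (n l - m k) fun x => A x l k) :
    BundleHom (splitBundle m) (splitBundle n) where
  app x := Matrix.toLin' (A x)
  holo := contMDiff_toLin' A hA

/-! ### Higgs fields -/

/-- The fibre of `K` is spanned by the vector with coordinate `1`, so one endomorphism per fibre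
determines the field. -/
lemma HiggsField.app_eq_smul {E : HolBundle} (φ : HiggsField E) (x : P1)
    (k : (lineCore (-2)).Fiber x) : φ.app x k = lineVal k • φ.app x (lineFiber (-2) x 1) := by
  have h : k = lineVal k • lineFiber (-2) x 1 := (mul_one (lineVal k)).symm
  conv_lhs => rw [h]
  exact _root_.map_smul _ _ _

/-- The endomorphism of the fibre at `x` of a split bundle given by a Higgs field and the element
of the fibre of `K` with coordinate `1`, in coordinates. -/
def HiggsField.coordMap {r : ℕ} {m : Fin r → ℤ} (φ : HiggsField (splitBundle m)) (x : P1) :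
    (Fin r → ℂ) →ₗ[ℂ] (Fin r → ℂ) := φ.app x (lineFiber (-2) x 1)

lemma HiggsField.app_eq_coordMap {r : ℕ} {m : Fin r → ℤ} (φ : HiggsField (splitBundle m)) (x : P1)
    (k : (lineCore (-2)).Fiber x) (v : (splitBundle m).Fiber x) :
    φ.app x k v = splitFiber m x (lineVal k • φ.coordMap x v) := by
  rw [φ.app_eq_smul]
  rfl

lemma HiggsField.contMDiff_coordMap {r : ℕ} {m : Fin r → ℤ} (φ : HiggsField (splitBundle m)) :
    ContMDiff (𝓘(ℂ).prod 𝓘(ℂ, ℂ × (Fin r → ℂ))) (𝓘(ℂ).prod 𝓘(ℂ, Fin r → ℂ)) ω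
      (fun p : TotalSpace (ℂ × (Fin r → ℂ)) ((lineCore (-2)).Fiber ×ᵇ (splitCore m).Fiber) =>
        (⟨p.1, splitFiber m p.1 (lineVal p.2.1 • φ.coordMap p.1 p.2.2)⟩ :
          TotalSpace (Fin r → ℂ) (splitCore m).Fiber)) := by
  have h : ContMDiff (𝓘(ℂ).prod 𝓘(ℂ, ℂ × (Fin r → ℂ))) (𝓘(ℂ).prod 𝓘(ℂ, Fin r → ℂ)) ω
      (fun p : TotalSpace (ℂ × (Fin r → ℂ)) ((lineCore (-2)).Fiber ×ᵇ (splitCore m).Fiber) =>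
        (⟨p.1, φ.app p.1 p.2.1 p.2.2⟩ : TotalSpace (Fin r → ℂ) (splitCore m).Fiber)) := φ.holo
  refine h.congr fun p => ?_
  exact congrArg (fun v => (⟨p.1, v⟩ : TotalSpace (Fin r → ℂ) (splitCore m).Fiber))
    (φ.app_eq_coordMap p.1 p.2.1 p.2.2).symm

/-- The entries of a Higgs field for a split bundle are holomorphic sections of line bundles. -/
lemma HiggsField.isHolSection_entry {r : ℕ} {m : Fin r → ℤ} (φ : HiggsField (splitBundle m))
    (l k : Fin r) : IsHolSection (m l - m k + 2) fun x => entry (φ.coordMap x) l k := by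
  intro x₀
  -- A local frame of `K = 𝒪(-2)` is paired with one of the bundle; its factor with exponent `2`
  -- produces the twist by `𝒪(2)`.
  have hs : ContMDiffAt 𝓘(ℂ) (𝓘(ℂ).prod 𝓘(ℂ, ℂ × (Fin r → ℂ))) ω
      (fun x => (⟨x, (lineFiber (-2) x (stdTrans (stdIndex x) (stdIndex x₀) x ^ (2 : ℤ)),
        splitFiber m x (stdTrans (stdIndex x) (stdIndex x₀) x ^ (-m k) • Pi.single k 1))⟩ :
          TotalSpace (ℂ × (Fin r → ℂ)) ((lineCore (-2)).Fiber ×ᵇ (splitCore m).Fiber))) x₀ := by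
    refine (Bundle.contMDiffAt_section x₀).2 (ContMDiffAt.prodMk_space ?_
      ((Bundle.contMDiffAt_section x₀).1 (contMDiffAt_splitFrame m k x₀)))
    have hc : ContMDiffAt 𝓘(ℂ) 𝓘(ℂ) ω (fun _ : P1 => (1 : ℂ)) x₀ := contMDiffAt_const
    refine hc.congr_of_eventuallyEq ?_
    filter_upwards [eventually_stdTrans_ne_zero x₀] with x hx
    change stdTrans (stdIndex x) (stdIndex x₀) x ^ (-2 : ℤ) *
      stdTrans (stdIndex x) (stdIndex x₀) x ^ (2 : ℤ) = 1
    rw [← zpow_add₀ hx]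
    simp
  have h := (φ.contMDiff_coordMap _).comp x₀ hs
  have h' := (contMDiffAt_pi_space.1 (Bundle.contMDiffAt_totalSpace.1 h).2) l
  refine h'.congr_of_eventuallyEq ?_
  filter_upwards [eventually_stdTrans_ne_zero x₀] with x hx
  change _ = stdTrans (stdIndex x) (stdIndex x₀) x ^ m l *
    (stdTrans (stdIndex x) (stdIndex x₀) x ^ (2 : ℤ) • φ.coordMap x
      (stdTrans (stdIndex x) (stdIndex x₀) x ^ (-m k) • Pi.single k 1)) l
  rw [_root_.map_smul, show m l - m k + 2 = m l + (-m k + 2) by ring, zpow_add₀ hx,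
    zpow_add₀ hx]
  simp only [Pi.smul_apply, smul_eq_mul, entry]
  ring

/-- The Higgs field `ψ φ ψ⁻¹` for `F` obtained from a Higgs field `φ` for `E` and an isomorphism
`ψ : E → F`. -/
def HiggsField.transport {E F : HolBundle} (φ : HiggsField E) (f : BundleHom E F)
    (g : BundleHom F E) : HiggsField F where
  app x := LinearMap.mk₂ ℂ (fun k v => f.app x (φ.app x k (g.app x v)))
    (by intros; simp) (by intros; simp) (by intros; simp) (by intros; simp)
  holo := by
    refine f.holo.comp (φ.holo.comp (f := fun p : TotalSpace (ℂ × (Fin F.rank → ℂ))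
      ((lineCore (-2)).Fiber ×ᵇ F.Fiber) => (⟨p.1, (p.2.1, g.app p.1 p.2.2)⟩ :
        TotalSpace (ℂ × (Fin E.rank → ℂ)) ((lineCore (-2)).Fiber ×ᵇ E.Fiber))) ?_)
    intro p₀
    have hid : ContMDiffAt (𝓘(ℂ).prod 𝓘(ℂ, ℂ × (Fin F.rank → ℂ)))
        (𝓘(ℂ).prod 𝓘(ℂ, ℂ × (Fin F.rank → ℂ))) ω
        (id : TotalSpace (ℂ × (Fin F.rank → ℂ)) ((lineCore (-2)).Fiber ×ᵇ F.Fiber) →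
          TotalSpace (ℂ × (Fin F.rank → ℂ)) ((lineCore (-2)).Fiber ×ᵇ F.Fiber)) p₀ :=
      contMDiffAt_id
    obtain ⟨hπ, hv⟩ := Bundle.contMDiffAt_totalSpace.1 hid
    have hk := (contDiff_fst (𝕜 := ℂ) (E := ℂ) (F := Fin F.rank → ℂ)
      (n := ω)).contMDiff.contMDiffAt.comp p₀ hv
    have hs := (contDiff_snd (𝕜 := ℂ) (E := ℂ) (F := Fin F.rank → ℂ)
      (n := ω)).contMDiff.contMDiffAt.comp p₀ hv
    have hsnd : ContMDiffAt (𝓘(ℂ).prod 𝓘(ℂ, ℂ × (Fin F.rank → ℂ)))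
        (𝓘(ℂ).prod 𝓘(ℂ, Fin F.rank → ℂ)) ω
        (fun p : TotalSpace (ℂ × (Fin F.rank → ℂ)) ((lineCore (-2)).Fiber ×ᵇ F.Fiber) =>
          (⟨p.1, p.2.2⟩ : TotalSpace (Fin F.rank → ℂ) F.Fiber)) p₀ :=
      Bundle.contMDiffAt_totalSpace.2 ⟨hπ, hs⟩
    exact Bundle.contMDiffAt_totalSpace.2 ⟨hπ, ContMDiffAt.prodMk_space hk
      (Bundle.contMDiffAt_totalSpace.1 ((g.holo _).comp p₀ hsnd)).2⟩

/-! ### Invariance of determinants -/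

instance (E : HolBundle) (x : P1) : FiniteDimensional ℂ (E.Fiber x) :=
  ((trivializationAt (Fin E.rank → ℂ) E.Fiber x).linearEquivAt ℂ x
    (FiberBundle.mem_baseSet_trivializationAt' x)).symm.finiteDimensional

lemma finrank_fiber (E : HolBundle) (x : P1) : Module.finrank ℂ (E.Fiber x) = E.rank := by
  rw [((trivializationAt (Fin E.rank → ℂ) E.Fiber x).linearEquivAt ℂ x
    (FiberBundle.mem_baseSet_trivializationAt' x)).finrank_eq]
  simp

lemma det_eq_of_intertwines {M N : Type*} [AddCommGroup M] [Module ℂ M] [AddCommGroup N]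
    [Module ℂ N] (e : M ≃ₗ[ℂ] N) (f : M →ₗ[ℂ] M) (g : N →ₗ[ℂ] N)
    (h : ∀ v, e (f v) = g (e v)) : LinearMap.det f = LinearMap.det g := by
  rw [← LinearMap.det_conj f e]
  congr 1
  ext v
  simp [h]

lemma trace_eq_of_intertwines {M N : Type*} [AddCommGroup M] [Module ℂ M] [AddCommGroup N]
    [Module ℂ N] (e : M ≃ₗ[ℂ] N) (f : M →ₗ[ℂ] M) (g : N →ₗ[ℂ] N)
    (h : ∀ v, e (f v) = g (e v)) : LinearMap.trace ℂ M f = LinearMap.trace ℂ N g := by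
  rw [← LinearMap.trace_conj' f e]
  congr 1
  ext v
  simp [LinearEquiv.conj_apply, h]

/-- The map `e` preserves the image of `i`, acts there as `a` and on the quotient as `b`: it is
block triangular. -/
lemma det_eq_mul_of_exact {A E B : Type*} [AddCommGroup A] [Module ℂ A] [AddCommGroup E]
    [Module ℂ E] [AddCommGroup B] [Module ℂ B] [FiniteDimensional ℂ E]
    (i : A →ₗ[ℂ] E) (p : E →ₗ[ℂ] B) (hi : Function.Injective i) (hp : Function.Surjective p)
    (hip : LinearMap.range i = LinearMap.ker p) (a : A →ₗ[ℂ] A) (e : E →ₗ[ℂ] E) (b : B →ₗ[ℂ] B)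
    (ha : ∀ v, i (a v) = e (i v)) (hb : ∀ v, p (e v) = b (p v)) :
    LinearMap.det e = LinearMap.det a * LinearMap.det b := by
  have he : LinearMap.range i ≤ (LinearMap.range i).comap e := by
    rintro _ ⟨v, rfl⟩
    exact ⟨a v, ha v⟩
  rw [LinearMap.det_eq_det_mul_det (LinearMap.range i) e he]
  congr 1
  · refine (det_eq_of_intertwines (LinearEquiv.ofInjective i hi) _ _ fun v => ?_).symm
    ext
    simp [ha]
  · refine det_eq_of_intertwines ((Submodule.quotEquivOfEq _ _ hip).trans
      (p.quotKerEquivOfSurjective hp)) _ _ fun v => ?_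
    obtain ⟨w, rfl⟩ := Submodule.Quotient.mk_surjective _ v
    simp [hb]

/-! ### Isomorphisms of co-Higgs bundles -/

/-- The isomorphism of the fibres at `x` given by an isomorphism of bundles. -/
def fiberEquiv {E F : HolBundle} (f : BundleHom E F) (g : BundleHom F E)
    (hgf : ∀ x v, g.app x (f.app x v) = v) (hfg : ∀ x v, f.app x (g.app x v) = v) (x : P1) :
    E.Fiber x ≃ₗ[ℂ] F.Fiber x :=
  LinearEquiv.ofLinearMap (f.app x) (g.app x) (LinearMap.ext (hfg x)) (LinearMap.ext (hgf x))

lemma BundleIso.rank_eq {E F : HolBundle} : BundleIso E F → E.rank = F.rank := by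
  rintro ⟨f, g, h, h'⟩
  rw [← finrank_fiber E ∞, ← finrank_fiber F ∞]
  exact (fiberEquiv f g h h' ∞).finrank_eq

/-- `HasDegree` indexes its summands by `Fin E.rank`; invariance of the rank reconciles this with
`Fin r`. -/
lemma hasDegree_of_iso_splitBundle {E : HolBundle} {r : ℕ} {m : Fin r → ℤ}
    (h : BundleIso E (splitBundle m)) : HasDegree E (∑ k, m k) := by
  obtain rfl : E.rank = r := h.rank_eq
  exact ⟨m, h, rfl⟩

lemma HasDegree.of_iso {E F : HolBundle} {d : ℤ} (hF : HasDegree F d) (h : BundleIso E F) :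
    HasDegree E d := by
  obtain ⟨m, hm, rfl⟩ := hF
  exact hasDegree_of_iso_splitBundle (h.trans hm)

lemma CoHiggsIso.bundleIso {c c' : CoHiggs} : CoHiggsIso c c' → BundleIso c.bundle c'.bundle :=
  fun ⟨f, g, h, h'⟩ => ⟨f.toBundleHom, g.toBundleHom, h, h'⟩

lemma CoHiggsIso.refl (c : CoHiggs) : CoHiggsIso c c :=
  ⟨⟨.refl _, fun _ _ _ => rfl⟩, ⟨.refl _, fun _ _ _ => rfl⟩, fun _ _ => rfl, fun _ _ => rfl⟩

lemma CoHiggsIso.symm {c c' : CoHiggs} : CoHiggsIso c c' → CoHiggsIso c' c :=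
  fun ⟨f, g, h, h'⟩ => ⟨g, f, h', h⟩

/-- The composition of two morphisms of co-Higgs bundles. -/
def CoHiggsHom.comp {c c' c'' : CoHiggs} (g : CoHiggsHom c' c'') (f : CoHiggsHom c c') :
    CoHiggsHom c c'' where
  toBundleHom := g.toBundleHom.comp f.toBundleHom
  comm x k v := by
    have h1 := f.comm x k v
    have h2 := g.comm x k (f.app x v)
    simp only [BundleHom.comp, LinearMap.comp_apply]
    rw [h1, h2]

lemma CoHiggsIso.trans {a b c : CoHiggs} : CoHiggsIso a b → CoHiggsIso b c → CoHiggsIso a c :=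
  fun ⟨f, g, h, h'⟩ ⟨f', g', k, k'⟩ => ⟨f'.comp f, g.comp g',
    fun x v => by simp [CoHiggsHom.comp, BundleHom.comp, k, h],
    fun x v => by simp [CoHiggsHom.comp, BundleHom.comp, k', h']⟩

lemma CoHiggsIso.det_eq {c c' : CoHiggs} (h : CoHiggsIso c c') (x : P1)
    (k : (lineCore (-2)).Fiber x) :
    LinearMap.det (c.field.app x k) = LinearMap.det (c'.field.app x k) := by
  obtain ⟨f, g, hgf, hfg⟩ := h
  exact det_eq_of_intertwines (fiberEquiv f.toBundleHom g.toBundleHom hgf hfg x) _ _ (f.comm x k)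

lemma CoHiggsIso.traceFree {c c' : CoHiggs} (h : CoHiggsIso c c') (hc : TraceFree c.field) :
    TraceFree c'.field := by
  obtain ⟨f, g, hgf, hfg⟩ := h
  intro x k
  rw [← hc x k]
  exact (trace_eq_of_intertwines (fiberEquiv f.toBundleHom g.toBundleHom hgf hfg x) _ _
    (f.comm x k)).symm

/-- An invariant subbundle of `c'` becomes one of `c`, with the same rank and degree, by composing
with the inverse isomorphism. -/
lemma CoHiggsIso.isStable {c c' : CoHiggs} (h : CoHiggsIso c c') (hc : IsStable c) :
    IsStable c' := by
  have hr := h.bundleIso.rank_eq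
  have hiso := h.bundleIso
  obtain ⟨f, g, hgf, hfg⟩ := h
  refine ⟨hr ▸ hc.1, fun U ι hU d e hd he => ?_⟩
  rw [← hr]
  refine hc.2 U (g.toBundleHom.comp ι) ⟨fun x => ?_, hU.rank_pos, hr ▸ hU.rank_lt, ?_⟩ d e hd
    (he.of_iso hiso)
  · exact (Function.LeftInverse.injective (hfg x)).comp (hU.injective x)
  · intro x k u
    obtain ⟨u', hu'⟩ := hU.invariant x k u
    refine ⟨u', ?_⟩
    have hg := g.comm x k (ι.app x u)
    rw [hu'] at hg
    exact hg.symm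

/-- Moves a co-Higgs bundle whose bundle is only isomorphic to `F` onto `F` itself. -/
lemma CoHiggsIso.transport {c : CoHiggs} {F : HolBundle} (f : BundleHom c.bundle F)
    (g : BundleHom F c.bundle) (hgf : ∀ x v, g.app x (f.app x v) = v)
    (hfg : ∀ x v, f.app x (g.app x v) = v) : CoHiggsIso c ⟨F, c.field.transport f g⟩ := by
  refine ⟨⟨f, fun x k v => ?_⟩, ⟨g, fun x k v => ?_⟩, hgf, hfg⟩
  · change f.app x (c.field.app x k v) = f.app x (c.field.app x k (g.app x (f.app x v)))
    rw [hgf]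
  · change g.app x (f.app x (c.field.app x k (g.app x v))) = c.field.app x k (g.app x v)
    rw [hgf]

/-- Through this, conjugacy inherits symmetry, transitivity and the invariance of determinants from
isomorphism. -/
lemma conjugate_iff_coHiggsIso {E : HolBundle} {φ φ' : HiggsField E} :
    Conjugate φ φ' ↔ CoHiggsIso ⟨E, φ⟩ ⟨E, φ'⟩ := by
  constructor
  · rintro ⟨ψ, ψ', h, h', hc⟩
    refine ⟨⟨ψ, fun x k v => ?_⟩, ⟨ψ', fun x k v => ?_⟩, h, h'⟩
    · change ψ.app x (φ.app x k v) = φ'.app x k (ψ.app x v)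
      rw [← hc, h]
    · change ψ'.app x (φ'.app x k v) = φ.app x k (ψ'.app x v)
      rw [← hc, h]
  · rintro ⟨f, g, h, h'⟩
    refine ⟨f.toBundleHom, g.toBundleHom, h, h', fun x k v => ?_⟩
    exact (f.comm x k (g.app x v)).trans (congrArg (φ'.app x k) (h' x v))

lemma IsStable.isSemistable {c : CoHiggs} (h : IsStable c) : IsSemistable c :=
  ⟨h.1, fun U ι hU d e hd he => (h.2 U ι hU d e hd he).le⟩

/-! ### S-equivalence -/

lemma IsExtension.det_eq {A E B : CoHiggs} (h : IsExtension A E B) (x : P1)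
    (k : (lineCore (-2)).Fiber x) : LinearMap.det (E.field.app x k) =
      LinearMap.det (A.field.app x k) * LinearMap.det (B.field.app x k) := by
  obtain ⟨i, p, hip⟩ := h
  obtain ⟨hi, hp, h⟩ := hip x
  exact det_eq_mul_of_exact _ _ hi hp h _ _ _ (i.comm x k) (p.comm x k)

lemma IsDirectSum.isExtension {A B G : CoHiggs} (h : IsDirectSum A B G) : IsExtension A G B := by
  obtain ⟨i, j, p, q, hpi, hqj, hsum⟩ := h
  refine ⟨i, q, fun x => ⟨Function.LeftInverse.injective (hpi x),
    Function.RightInverse.surjective (hqj x), le_antisymm ?_ fun v hv => ?_⟩⟩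
  · rintro _ ⟨v, rfl⟩
    -- The relation `q ∘ i = 0` is not part of `IsDirectSum`: evaluating the sum relation on `i v`
    -- gives `j (q (i v)) = 0`, and `q` is a left inverse of `j`.
    have h := hsum x (i.app x v)
    rw [hpi, add_eq_left] at h
    rw [LinearMap.mem_ker, ← hqj x (q.app x (i.app x v)), h, _root_.map_zero]
  · have h := hsum x v
    rw [LinearMap.mem_ker.1 hv, _root_.map_zero, add_zero] at h
    exact ⟨_, h⟩

/-- Each step of the filtration multiplies by the determinant on the stable quotient, both for the
extension and for the direct sum. -/
lemma IsGraded.det_eq {E G : CoHiggs} (h : IsGraded E G) (x : P1)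
    (k : (lineCore (-2)).Fiber x) :
    LinearMap.det (E.field.app x k) = LinearMap.det (G.field.app x k) := by
  induction h with
  | stable _ h => exact h.det_eq x k
  | extend _ _ _ hext _ _ _ hsum ih => rw [hext.det_eq, hsum.isExtension.det_eq, ih]

/-- A stable object is its own associated graded object, so `c'` serves for both. -/
lemma sEquivalent_of_iso {c c' : CoHiggs} (hc : IsStable c) (h : CoHiggsIso c c') :
    SEquivalent c c' :=
  ⟨c', .stable hc h, .stable (h.isStable hc) (.refl c')⟩

/-- Equality in the quotient holds for the equivalence relation generated by S-equivalence. Lifting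
the determinant to the quotient avoids proving that S-equivalence is transitive. -/
lemma det_eq_of_mk_eq {r : ℕ} {d : ℤ} {c c' : CoHiggs} (hc : IsModuliObject r d c)
    (hc' : IsModuliObject r d c') (h : M0.mk c hc = M0.mk c' hc') (x : P1)
    (k : (lineCore (-2)).Fiber x) :
    LinearMap.det (c.field.app x k) = LinearMap.det (c'.field.app x k) := by
  refine congrArg (Quot.lift (fun c : {c : CoHiggs // IsModuliObject r d c} =>
    LinearMap.det (c.1.field.app x k)) ?_) h
  rintro a b ⟨G, ha, hb⟩
  exact (ha.det_eq x k).trans (hb.det_eq x k).symm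

/-! ### The bundle `𝒪(1) ⊕ 𝒪(-1)` -/

lemma apply_fin_two (f : (Fin 2 → ℂ) →ₗ[ℂ] (Fin 2 → ℂ)) (v : Fin 2 → ℂ) (l : Fin 2) :
    f v l = entry f l 0 * v 0 + entry f l 1 * v 1 := by
  rw [apply_eq_sum_entry, Fin.sum_univ_two]

lemma det_eq_entry (f : (Fin 2 → ℂ) →ₗ[ℂ] (Fin 2 → ℂ)) :
    LinearMap.det f = entry f 0 0 * entry f 1 1 - entry f 0 1 * entry f 1 0 := by
  rw [← LinearMap.det_toMatrix', Matrix.det_fin_two]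
  simp [LinearMap.toMatrix'_apply, entry]

lemma trace_eq_entry (f : (Fin 2 → ℂ) →ₗ[ℂ] (Fin 2 → ℂ)) :
    LinearMap.trace ℂ (Fin 2 → ℂ) f = entry f 0 0 + entry f 1 1 := by
  rw [LinearMap.trace_eq_matrix_trace ℂ (Pi.basisFun ℂ (Fin 2)), Matrix.trace_fin_two]
  simp [entry]

lemma hasDegree_splitBundle {r : ℕ} (m : Fin r → ℤ) : HasDegree (splitBundle m) (∑ k, m k) :=
  hasDegree_of_iso_splitBundle (.refl _)

lemma hasDegree_E11 : HasDegree E11 0 := hasDegree_splitBundle ![1, -1]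

/-- The determinant of the isomorphism is a nowhere vanishing section of `𝒪(m 0 + m 1)`. This is all
the uniqueness of degrees that the stability arguments require. -/
lemma sum_eq_zero_of_iso_E11 {m : Fin 2 → ℤ} (h : BundleIso E11 (splitBundle m)) :
    m 0 + m 1 = 0 := by
  obtain ⟨f, g, hgf, -⟩ := h
  have hsec := ((BundleHom.isHolSection_entry f 0 0).mul (BundleHom.isHolSection_entry f 1 1)).sub
    (((BundleHom.isHolSection_entry f 0 1).mul (BundleHom.isHolSection_entry f 1 0)).congr
      (by simp) fun _ => rfl)
  have h0 := hsec.degree_eq_zero fun x => by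
    rw [← det_eq_entry]
    have hmul : LinearMap.det (BundleHom.coordMap g x) * LinearMap.det (BundleHom.coordMap f x) =
        1 := by
      rw [← LinearMap.det_comp]
      have : BundleHom.coordMap g x ∘ₗ BundleHom.coordMap f x = LinearMap.id :=
        LinearMap.ext (hgf x)
      rw [this, LinearMap.det_id]
    exact right_ne_zero_of_mul_eq_one hmul
  simp at h0
  omega

lemma HasDegree.eq_zero_of_E11 {e : ℤ} (h : HasDegree E11 e) : e = 0 := by
  obtain ⟨m, hm, rfl⟩ := h
  exact (Fin.sum_univ_two m).trans (sum_eq_zero_of_iso_E11 hm)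

/-! ### Line subbundles and the stability criterion -/

/-- The component in `𝒪(-1)` is a section of `𝒪(-1 - m 0)`, which has negative degree. -/
lemma second_coord_eq_zero_of_splitBundle {r : ℕ} {m : Fin r → ℤ}
    (f : BundleHom (splitBundle m) E11) (hr : r = 1) (h0 : 0 ≤ ∑ k, m k) (x : P1)
    (v : Fin r → ℂ) : BundleHom.coordMap f x v 1 = 0 := by
  subst hr
  rw [apply_eq_sum_entry, Fin.sum_univ_one,
    (BundleHom.isHolSection_entry f 1 0).eq_zero_of_neg, zero_mul]
  rw [Fin.sum_univ_one] at h0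
  simp
  omega

/-- A line subbundle of `𝒪(1) ⊕ 𝒪(-1)` of nonnegative degree lies in `𝒪(1)`. -/
lemma second_coord_eq_zero {U : HolBundle} (ι : BundleHom U E11) {d : ℤ} (hU : U.rank = 1)
    (hd : HasDegree U d) (h0 : 0 ≤ d) (x : P1) (u : U.Fiber x) :
    (ι.app x u : Fin 2 → ℂ) 1 = 0 := by
  obtain ⟨m, ⟨f, g, hgf, -⟩, rfl⟩ := hd
  have h := second_coord_eq_zero_of_splitBundle (ι.comp g) hU h0 x (f.app x u)
  change (ι.app x (g.app x (f.app x u)) : Fin 2 → ℂ) 1 = 0 at h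
  rwa [hgf] at h

/-- A subbundle of degree `≥ 0` would lie in `𝒪(1)`. For a nonzero vector `(a, 0)` of it, invariance
makes the second coordinate of its image, the lower left entry times `a`, vanish. One fibre
suffices, here that at `∞`. -/
lemma isStable_of_entry_ne_zero (φ : HiggsField E11)
    (hφ : ∀ x, entry (HiggsField.coordMap φ x) 1 0 ≠ 0) : IsStable ⟨E11, φ⟩ := by
  refine ⟨Nat.succ_pos 1, fun U ι hU d e hd he => ?_⟩
  obtain rfl : e = 0 := he.eq_zero_of_E11
  have hr : U.rank = 1 := le_antisymm (Nat.lt_succ_iff.1 hU.rank_lt) hU.rank_pos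
  have hd0 : d < 0 := by
    by_contra! hd0
    have hz := second_coord_eq_zero ι hr hd hd0 ∞
    have : Nontrivial (U.Fiber ∞) := by
      apply Module.nontrivial_of_finrank_pos (R := ℂ)
      rw [finrank_fiber, hr]
      exact one_pos
    obtain ⟨u, hu⟩ := exists_ne (0 : U.Fiber ∞)
    have hne : ι.app ∞ u ≠ 0 := fun h => hu (hU.injective ∞ (h.trans (_root_.map_zero _).symm))
    obtain ⟨u', hu'⟩ := hU.invariant ∞ (lineFiber (-2) ∞ 1) u
    have h1 : HiggsField.coordMap φ ∞ (ι.app ∞ u) 1 = 0 :=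
      (congrFun (hu' : _ = (ι.app ∞ u' : Fin 2 → ℂ)) 1).trans (hz u')
    replace h1 := (apply_fin_two _ (ι.app ∞ u) 1).symm.trans h1
    rw [hz u, mul_zero, add_zero] at h1
    refine hne (funext fun i => ?_ : (ι.app ∞ u : Fin 2 → ℂ) = 0)
    fin_cases i
    · exact (mul_eq_zero.1 h1).resolve_left (hφ ∞)
    · exact hz u
  change d * 2 < 0 * U.rank
  omega

/-- The lower left entry of a Higgs field for `𝒪(1) ⊕ 𝒪(-1)` is constant. -/
lemma entry_eq_const (φ : HiggsField E11) (x : P1) :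
    entry (HiggsField.coordMap φ x) 1 0 = entry (HiggsField.coordMap φ ∞) 1 0 :=
  -- The degree is `-1 - 1 + 2 = 0`.
  ((HiggsField.isHolSection_entry φ 1 0).congr (m := 0) (by simp) fun _ => rfl).eq_const x

/-- The inclusion of `𝒪(1)` in `𝒪(1) ⊕ 𝒪(-1)`. -/
def inclLine : BundleHom (splitBundle ![1]) E11 :=
  BundleHom.ofMatrix (fun _ => !![1; 0]) fun l k => by
    fin_cases l <;> fin_cases k
    · exact isHolSection_const 1
    · exact isHolSection_zero _

lemma inclLine_apply (x : P1) (u : Fin 1 → ℂ) :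
    (inclLine.app x u : Fin 2 → ℂ) = ![u 0, 0] := by
  change Matrix.toLin' !![1; 0] u = _
  ext i
  fin_cases i <;> simp [Matrix.mulVec, dotProduct]

/-- The entry is constant, so one zero makes it vanish identically; then `𝒪(1)` is invariant, of
slope `1 > 0`. -/
lemma IsStable.entry_ne_zero {φ : HiggsField E11} (h : IsStable ⟨E11, φ⟩) (x : P1) :
    entry (HiggsField.coordMap φ x) 1 0 ≠ 0 := by
  intro hx
  have h0 : ∀ y, entry (HiggsField.coordMap φ y) 1 0 = 0 := fun y => by
    rw [entry_eq_const φ y, ← entry_eq_const φ x, hx]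
  have hU : IsInvariantSubbundle ⟨E11, φ⟩ (splitBundle ![1]) inclLine := by
    refine ⟨fun y u v huv => ?_, Nat.one_pos, Nat.one_lt_two, fun y k u => ?_⟩
    · have h := (inclLine_apply y u).symm.trans (huv.trans (inclLine_apply y v))
      exact funext fun i : Fin 1 => by
        rw [Subsingleton.elim i 0]
        exact congrFun h 0
    · refine ⟨splitFiber ![1] y
        fun _ => lineVal k * (entry (HiggsField.coordMap φ y) 0 0 * (u : Fin 1 → ℂ) 0), ?_⟩
      refine Eq.trans ?_ (inclLine_apply y _).symm
      refine (HiggsField.app_eq_coordMap φ y k _).trans ?_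
      refine funext fun l : Fin 2 => ?_
      have h : (inclLine.app y u : Fin 2 → ℂ) = ![(u : Fin 1 → ℂ) 0, 0] := inclLine_apply y u
      refine (congrArg (fun v : Fin 2 → ℂ => lineVal k * HiggsField.coordMap φ y v l) h).trans ?_
      simp only [apply_fin_two]
      fin_cases l
      · simp [splitFiber]
      · simp [h0]
  have hlt := h.2 _ _ hU 1 0 (hasDegree_splitBundle ![1]) hasDegree_E11
  change (1 : ℤ) * (2 : ℕ) < 0 * (1 : ℕ) at hlt
  norm_num at hlt

/-! ### The companion fields -/

lemma coordMap_Qfield (ρ : H0 4) (x : P1) (v : Fin 2 → ℂ) :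
    HiggsField.coordMap (Qfield ρ) x v = ![-lineVal (ρ x) * v 1, v 0] := by
  refine (qMap_apply (lineVal (ρ x)) 1 v).trans ?_
  simp

lemma isStable_Q (ρ : H0 4) : IsStable (Q ρ) := by
  refine isStable_of_entry_ne_zero _ fun x => ?_
  rw [entry, coordMap_Qfield]
  simp

lemma HiggsField.app_eq_smul_coordMap (φ : HiggsField E11) (x : P1)
    (k : (lineCore (-2)).Fiber x) :
    φ.app x k = lineVal k • HiggsField.coordMap φ x :=
  φ.app_eq_smul x k

lemma det_app_E11 (φ : HiggsField E11) (x : P1) (k : (lineCore (-2)).Fiber x) :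
    LinearMap.det (φ.app x k) = LinearMap.det (HiggsField.coordMap φ x) * lineVal k ^ 2 := by
  rw [HiggsField.app_eq_smul_coordMap]
  refine (LinearMap.det_smul (M := Fin 2 → ℂ) (lineVal k) (HiggsField.coordMap φ x)).trans ?_
  simp [mul_comm]

lemma hasDet_Qfield (ρ : H0 4) : HasDet (Qfield ρ) ρ := by
  intro x k
  rw [det_app_E11, det_eq_entry]
  simp [entry, coordMap_Qfield]

lemma traceFree_Qfield (ρ : H0 4) : TraceFree (Qfield ρ) := by
  intro x k
  rw [HiggsField.app_eq_smul_coordMap]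
  refine (_root_.map_smul (LinearMap.trace ℂ (Fin 2 → ℂ)) (lineVal k) _).trans ?_
  rw [trace_eq_entry]
  simp [entry, coordMap_Qfield]

lemma isModuliObject_Q (ρ : H0 4) : IsModuliObject 2 0 (Q ρ) :=
  ⟨rfl, hasDegree_E11, traceFree_Qfield ρ, (isStable_Q ρ).isSemistable⟩

/-- Evaluating on the generator of the fibre of `K` recovers the value of the section. -/
lemma HasDet.unique {E : HolBundle} {φ : HiggsField E} {ρ ρ' : H0 4} (h : HasDet φ ρ)
    (h' : HasDet φ ρ') : ρ = ρ' := by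
  refine H0_ext fun x => ?_
  have h1 := (h x (lineFiber (-2) x 1)).symm.trans (h' x (lineFiber (-2) x 1))
  have hone : lineVal (lineFiber (-2) x 1) = 1 := rfl
  simpa only [hone, one_pow, mul_one] using h1

/-- The determinant of a Higgs field for `𝒪(1) ⊕ 𝒪(-1)`. -/
lemma exists_hasDet (φ : HiggsField E11) : ∃ ρ : H0 4, HasDet φ ρ := by
  -- Both terms of the `2 × 2` determinant have degree `4`: `2 + 2` on the diagonal and `4 + 0` off
  -- it.
  have h := (((HiggsField.isHolSection_entry φ 0 0).mul
    (HiggsField.isHolSection_entry φ 1 1)).congr (m := 4) (by simp) fun _ => rfl).sub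
    (((HiggsField.isHolSection_entry φ 0 1).mul (HiggsField.isHolSection_entry φ 1 0)).congr
      (by simp) fun _ => rfl)
  refine ⟨h.toH0, fun x k => ?_⟩
  rw [det_app_E11, det_eq_entry]
  rfl

/-- A stable trace-free Higgs field for `𝒪(1) ⊕ 𝒪(-1)` is conjugate to the
companion field of its determinant. -/
lemma conjugate_Qfield {φ : HiggsField E11} {ρ : H0 4} (hφ : TraceFree φ)
    (hst : IsStable ⟨E11, φ⟩) (hρ : HasDet φ ρ) : Conjugate φ (Qfield ρ) := by
  set A : P1 → (Fin 2 → ℂ) →ₗ[ℂ] (Fin 2 → ℂ) := HiggsField.coordMap φ with hA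
  have hc : ∀ x, entry (A x) 1 0 ≠ 0 := hst.entry_ne_zero
  have hsec := HiggsField.isHolSection_entry φ
  have ha : IsHolSection 2 fun x => entry (A x) 0 0 := (hsec 0 0).congr (by simp) fun _ => rfl
  have hcs : IsHolSection 0 fun x => entry (A x) 1 0 := (hsec 1 0).congr (by simp) fun _ => rfl
  have htr : ∀ x, entry (A x) 1 1 = -entry (A x) 0 0 := fun x => by
    have h := (trace_eq_entry (A x)).symm.trans (hφ x (lineFiber (-2) x 1))
    linear_combination h
  have hdet : ∀ x, lineVal (ρ x) = -entry (A x) 0 0 ^ 2 - entry (A x) 0 1 * entry (A x) 1 0 :=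
    fun x => by
      have h := hρ x (lineFiber (-2) x 1)
      rw [det_app_E11, det_eq_entry, ← hA, htr] at h
      have h1 : lineVal (lineFiber (-2) x 1) = 1 := rfl
      rw [h1] at h
      linear_combination -h
  -- Write the field as `!![a, b; c, -a]` and fix the second row of `ψ` as `(0, 1)`. The second row
  -- of `ψ φ = Q ψ` forces the first row of `ψ` to be `(c, -a)`. The other row then holds because
  -- `(c, -a) φ = (0, a ^ 2 + b * c) = (0, -ρ)`. The determinant of `ψ` is `c`, which never
  -- vanishes.
  let ψ : BundleHom E11 E11 := BundleHom.ofMatrix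
    (fun x => !![entry (A x) 1 0, -entry (A x) 0 0; 0, 1]) fun l k => by
      fin_cases l <;> fin_cases k
      · exact hcs
      · exact ha.neg
      · exact isHolSection_zero _
      · exact isHolSection_const 1
  let ψ' : BundleHom E11 E11 := BundleHom.ofMatrix
    (fun x => !![(entry (A x) 1 0)⁻¹, entry (A x) 0 0 * (entry (A x) 1 0)⁻¹; 0, 1]) fun l k => by
      fin_cases l <;> fin_cases k
      · exact hcs.inv hc
      · exact ha.mul (hcs.inv hc)
      · exact isHolSection_zero _
      · exact isHolSection_const 1
  have hψ : ∀ x (v : Fin 2 → ℂ), (ψ.app x v : Fin 2 → ℂ) =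
      ![entry (A x) 1 0 * v 0 - entry (A x) 0 0 * v 1, v 1] := fun x v => by
    change Matrix.toLin' !![_, _; _, _] v = _
    ext i
    fin_cases i <;> simp [Matrix.mulVec, dotProduct, Fin.sum_univ_two, sub_eq_add_neg]
  have hψ' : ∀ x (v : Fin 2 → ℂ), (ψ'.app x v : Fin 2 → ℂ) =
      ![(entry (A x) 1 0)⁻¹ * (v 0 + entry (A x) 0 0 * v 1), v 1] := fun x v => by
    change Matrix.toLin' !![_, _; _, _] v = _
    ext i
    fin_cases i <;> simp [Matrix.mulVec, dotProduct, Fin.sum_univ_two]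
    ring
  have hinv : ∀ x (v : Fin 2 → ℂ), ψ'.app x (ψ.app x v) = v := fun x v => by
    refine (hψ' x _).trans ?_
    rw [hψ]
    refine funext fun i : Fin 2 => ?_
    fin_cases i <;> simp [hc]
  have hinv' : ∀ x (v : Fin 2 → ℂ), ψ.app x (ψ'.app x v) = v := fun x v => by
    refine (hψ x _).trans ?_
    rw [hψ']
    refine funext fun i : Fin 2 => ?_
    fin_cases i <;> simp [hc]
  have hcomm : ∀ x (k : (lineCore (-2)).Fiber x) (v : Fin 2 → ℂ),
      ψ.app x (φ.app x k v) = (Qfield ρ).app x k (ψ.app x v) := fun x k v => by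
    refine (hψ x _).trans ?_
    refine Eq.trans ?_ (qMap_apply (lineVal (ρ x)) (lineVal k) (ψ.app x v)).symm
    rw [hψ]
    have happ : ∀ l, (φ.app x k v : Fin 2 → ℂ) l = lineVal k * A x v l := fun l =>
      congrFun (HiggsField.app_eq_coordMap φ x k v : _ = (_ : Fin 2 → ℂ)) l
    rw [happ, happ, apply_fin_two, apply_fin_two, htr, hdet]
    refine funext fun i : Fin 2 => ?_
    fin_cases i
    · simp
      ring
    · simp only [Fin.mk_one, Matrix.cons_val_one, Matrix.cons_val_fin_one,
        Matrix.cons_val_zero]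
      ring
  exact conjugate_iff_coHiggsIso.2 ⟨⟨ψ, hcomm⟩, (⟨ψ', fun x k v => by
    change ψ'.app x ((Qfield ρ).app x k v) = φ.app x k (ψ'.app x v)
    refine Eq.trans (congrArg (ψ'.app x) ?_) (hinv x (φ.app x k (ψ'.app x v)))
    exact ((hcomm x k (ψ'.app x v)).trans (congrArg ((Qfield ρ).app x k) (hinv' x v))).symm⟩ : CoHiggsHom (Q ρ) ⟨E11, φ⟩),
    hinv, hinv'⟩

lemma Conjugate.det_eq {E : HolBundle} {φ φ' : HiggsField E} (h : Conjugate φ φ') (x : P1)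
    (k : (lineCore (-2)).Fiber x) :
    LinearMap.det (φ.app x k) = LinearMap.det (φ'.app x k) :=
  (conjugate_iff_coHiggsIso.1 h).det_eq x k

/-- For the harder inclusion, the field is transported to `E11` and conjugated to its companion
field; the resulting isomorphism of stable objects gives S-equivalence. -/
lemma stableLocus_E11_eq_range :
    Set.range (fun ρ : H0 4 => M0.mk (Q ρ) (isModuliObject_Q ρ)) = stableLocus E11 := by
  ext p
  constructor
  · rintro ⟨ρ, rfl⟩
    exact ⟨Q ρ, isModuliObject_Q ρ, isStable_Q ρ, .refl _, rfl⟩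
  · rintro ⟨c, hc, hst, ⟨f, g, hgf, hfg⟩, rfl⟩
    have hiso := CoHiggsIso.transport f g hgf hfg
    obtain ⟨ρ, hρ⟩ := exists_hasDet (c.field.transport f g)
    have hconj := conjugate_Qfield (hiso.traceFree hc.traceFree) (hiso.isStable hst) hρ
    have heq : SEquivalent c (Q ρ) :=
      sEquivalent_of_iso hst (hiso.trans (conjugate_iff_coHiggsIso.1 hconj))
    exact ⟨ρ, (Quot.sound heq :
      M0.mk c hc = M0.mk (Q ρ) (isModuliObject_Q ρ)).symm⟩

end CoHiggsP1

end

theorem proposition8p1 :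
    -- each `(𝒪(1) ⊕ 𝒪(-1), Q(ρ))` represents a point of `M₀(2, 0)`
    ∃ hQ : ∀ ρ : H0 4, IsModuliObject 2 0 (Q ρ),
      -- it is stable, and `ρ ↦ [Q(ρ)]` is a section of the Hitchin map
      (∀ ρ : H0 4, IsStable (Q ρ)) ∧
      (∀ ρ : H0 4, HitchinMapsTo (M0.mk (Q ρ) (hQ ρ)) ρ) ∧
      -- the image of the section is the locus of the stable co-Higgs bundles on `𝒪(1) ⊕ 𝒪(-1)`
      Set.range (fun ρ : H0 4 => M0.mk (Q ρ) (hQ ρ)) = stableLocus E11 ∧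
      -- each stable trace-free field on `𝒪(1) ⊕ 𝒪(-1)` is conjugate to `Q(ρ)` for exactly one `ρ`,
      -- which is its determinant
      (∀ φ : HiggsField E11, TraceFree φ → IsStable ⟨E11, φ⟩ →
        ∃ ρ : H0 4, HasDet φ ρ ∧ ∀ ρ' : H0 4, Conjugate φ (Qfield ρ') ↔ ρ' = ρ) ∧
      -- two such fields are conjugate if and only if they have the same `-det`
      (∀ φ φ' : HiggsField E11, TraceFree φ → TraceFree φ' →
        IsStable ⟨E11, φ⟩ → IsStable ⟨E11, φ'⟩ →
        (Conjugate φ φ' ↔ ∀ x k, -LinearMap.det (φ.app x k) = -LinearMap.det (φ'.app x k))) := by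
  refine ⟨isModuliObject_Q, isStable_Q, fun ρ c hc h x k => ?_, stableLocus_E11_eq_range,
    fun φ hφ hst => ?_, fun φ φ' hφ hφ' hst hst' => ⟨fun h x k => ?_, fun h => ?_⟩⟩
  · rw [det_eq_of_mk_eq hc (isModuliObject_Q ρ) h]
    exact hasDet_Qfield ρ x k
  · obtain ⟨ρ, hρ⟩ := exists_hasDet φ
    refine ⟨ρ, hρ, fun ρ' => ⟨fun h => ?_, ?_⟩⟩
    -- Conjugation preserves the determinant, so `ρ'` is also a determinant of `φ`.
    · exact HasDet.unique (fun x k => (h.det_eq x k).trans (hasDet_Qfield ρ' x k)) hρ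
    · rintro rfl
      exact conjugate_Qfield hφ hst hρ
  · rw [h.det_eq]
  · obtain ⟨ρ, hρ⟩ := exists_hasDet φ
    -- Both fields are conjugate to the same companion field.
    have hρ' : HasDet φ' ρ := fun x k => (neg_injective (h x k)).symm.trans (hρ x k)
    have h1 := conjugate_iff_coHiggsIso.1 (conjugate_Qfield hφ hst hρ)
    have h2 := conjugate_iff_coHiggsIso.1 (conjugate_Qfield hφ' hst' hρ')
    exact conjugate_iff_coHiggsIso.2 (h1.trans h2.symm)
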